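/- Let $N$ be a dimension and let $f:\mathbb{R}\to\mathbb{R}$, $J,\rho,h:\mathbb{R}^N\to\mathbb{R}$ satisfy: $J\ge 0$ is integrable; $\rho\ge 0$ is bounded, integrable and symmetric ($\rho(-x)=\rho(x)$); $h$ is bounded and differentiable with bounded derivative; $f$ is globally Lipschitz and bounded, and $|f(s)|\le \eta|s|+K$ for all $s\in\mathbb{R}$, where $\eta\,\|J\|_{1}\|\rho\|_\infty<1$, $\|J\|_1=\int|J|$ and $\|\rho\|_\infty=\sup_x|\rho(x)|$. Let $C_\rho(\mathbb{R}^N)$ be the space of continuous $u:\mathbb{R}^N\to\mathbb{R}$ with $\|u\|_\rho:=\sup_x|u(x)|\rho(x)<\infty$, with the topology given by $\|\cdot\|_\rho$ (a norm if $\rho>0$, a seminorm in general), and let $B_\rho(0,R)$ be its closed ball of radius $R$ about $0$. Then the equation $$\frac{\partial u}{\partial t}(x,t)+u(x,t)=\int_{\mathbb{R}^N}J(x-y)f(u(y,t))\rho(y)\,dy+h(x)$$ generates a continuous semiflow $T(t)$, $t\ge0$, on $C_\rho(\mathbb{R}^N)$: the solutions $u:[0,\infty)\to C_\rho(\mathbb{R}^N)$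 (differentiable with respect to $\|\cdot\|_\rho$, with the equation holding also at every point $x$) are exactly the curves $t\mapsto T(t)u_0$ with $u_0\in C_\rho(\mathbb{R}^N)$. Call a set absorbing if for every bounded $C\subset C_\rho(\mathbb{R}^N)$ there is $t_1>0$ such that it contains $T(t)C$ for all $t\ge t_1$; a global attractor is a compact set $\mathcal{A}$ with $T(t)\mathcal{A}=\mathcal{A}$ for all $t\ge0$ that attracts every bounded set $C$, i.e. for every $\varepsilon>0$ the set $T(t)C$ lies in the $\varepsilon$-neighbourhood of $\mathcal{A}$ for all large $t$. Let $$\omega(B)=\bigcap_{t_0\ge0}\overline{\bigcup_{t\ge t_0}T(t)B}.$$ (i) If $\eta\|J\|_1\|\rho\|_\infty<\delta<1$ and $$R\ \ge\ \frac{\|J\|_1\|\rho\|_\infty^2K+\|h\|_\rho}{\delta-\eta\|J\|_1\|\rho\|_\infty},$$ then $B_\rho(0,R)$ is absorbing if $R>0$, the set $\mathcal{A}=\omega(B_\rho(0,R))$ is a global attractor for $T(t)$ in $C_\rho(\mathbb{R}^N)$, and $\mathcal{A}\subset B_\rho(0,R)$. (ii) More generally, for every $R$ for which $B_\rho(0,R)$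 is absorbing, $\mathcal{A}=\omega(B_\rho(0,R))$ is a global attractor for $T(t)$ in $C_\rho(\mathbb{R}^N)$ and $\mathcal{A}\subset B_\rho(0,R)$. -/

import Mathlib

open Set Filter Topology MeasureTheory
open scoped NNReal

noncomputable section

/-- The continuous functions `u` on `ℝᴺ` for which `u * ρ` is bounded, as a vector space. -/
def weightedSubmodule {N : ℕ} (ρ : EuclideanSpace ℝ (Fin N) → ℝ) :
    Submodule ℝ (EuclideanSpace ℝ (Fin N) → ℝ) where
  carrier := {u | Continuous u ∧ BddAbove (range fun x => |u x| * |ρ x|)}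
  zero_mem' := by
    refine ⟨continuous_zero, 0, ?_⟩
    rintro _ ⟨x, rfl⟩
    simp
  add_mem' := by
    rintro u v ⟨hu, a, ha⟩ ⟨hv, b, hb⟩
    refine ⟨hu.add hv, a + b, ?_⟩
    rintro _ ⟨x, rfl⟩
    have h1 := ha ⟨x, rfl⟩
    have h2 := hb ⟨x, rfl⟩
    have h3 := mul_le_mul_of_nonneg_right (abs_add_le (u x) (v x)) (abs_nonneg (ρ x))
    simp only [Pi.add_apply] at *
    linarith
  smul_mem' := by
    rintro c u ⟨hu, a, ha⟩
    refine ⟨hu.const_smul c, |c| * a, ?_⟩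
    rintro _ ⟨x, rfl⟩
    have h1 := mul_le_mul_of_nonneg_left (ha ⟨x, rfl⟩) (abs_nonneg c)
    simpa [abs_mul, mul_assoc] using h1

/-- The space `C_ρ(ℝᴺ)`. -/
def CRho {N : ℕ} (ρ : EuclideanSpace ℝ (Fin N) → ℝ) : Type := weightedSubmodule ρ

namespace CRho

variable {N : ℕ} {ρ : EuclideanSpace ℝ (Fin N) → ℝ}

instance : AddCommGroup (CRho ρ) := inferInstanceAs (AddCommGroup (weightedSubmodule ρ))

instance : Module ℝ (CRho ρ) := inferInstanceAs (Module ℝ (weightedSubmodule ρ))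

instance : CoeFun (CRho ρ) fun _ => EuclideanSpace ℝ (Fin N) → ℝ := ⟨fun u => u.1⟩

theorem bddAbove (u : CRho ρ) : BddAbove (range fun x => |u x| * |ρ x|) := u.2.2

theorem add_apply (u v : CRho ρ) (x : EuclideanSpace ℝ (Fin N)) : (u + v) x = u x + v x := rfl

theorem smul_apply (c : ℝ) (u : CRho ρ) (x : EuclideanSpace ℝ (Fin N)) :
    (c • u) x = c * u x := rfl

/-- The weighted supremum `‖u‖_ρ = sup_x |u x| ρ x`. It is a seminorm for every weight, and a norm
as soon as the weight is positive. -/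
def weightedSeminorm (ρ : EuclideanSpace ℝ (Fin N) → ℝ) : AddGroupSeminorm (CRho ρ) where
  toFun u := ⨆ x, |u x| * |ρ x|
  map_zero' := by
    have h : ∀ x, |(0 : CRho ρ) x| * |ρ x| = 0 := fun x => by
      change |(0 : ℝ)| * |ρ x| = 0
      simp
    simp only [h, ciSup_const]
  add_le' u v := by
    refine ciSup_le fun x => ?_
    have h1 := le_ciSup u.bddAbove x
    have h2 := le_ciSup v.bddAbove x
    have h3 := mul_le_mul_of_nonneg_right (abs_add_le (u x) (v x)) (abs_nonneg (ρ x))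
    rw [add_apply]
    linarith
  neg' u := by
    have h : ∀ x, |(-u) x| = |u x| := fun x => abs_neg (u x)
    simp only [h]

instance : SeminormedAddCommGroup (CRho ρ) :=
  { (weightedSeminorm ρ).toSeminormedAddCommGroup with
    toAddCommGroup := inferInstance }

theorem norm_eq (u : CRho ρ) : ‖u‖ = ⨆ x, |u x| * |ρ x| := rfl

instance : NormedSpace ℝ (CRho ρ) where
  norm_smul_le c u := by
    rw [norm_eq, norm_eq, Real.norm_eq_abs, Real.mul_iSup_of_nonneg (abs_nonneg c)]
    refine le_of_eq (iSup_congr fun x => ?_)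
    rw [smul_apply, abs_mul, mul_assoc]

end CRho

/-- The right-hand side `-u(x) + ∫ J(x - y) f(u(y)) ρ(y) dy + h(x)` of the evolution equation. -/
def nonlocalField {N : ℕ} (J ρ h : EuclideanSpace ℝ (Fin N) → ℝ) (f : ℝ → ℝ)
    (u : EuclideanSpace ℝ (Fin N) → ℝ) (x : EuclideanSpace ℝ (Fin N)) : ℝ :=
  -u x + (∫ y, J (x - y) * f (u y) * ρ y) + h x

/-- A solution on `[0, ∞)` of the evolution equation in `C_ρ(ℝᴺ)`: the curve `u` is differentiable
with respect to `‖·‖_ρ`, its derivative is the right-hand side of the equation, and the equation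
holds at every point `x`. (The last clause follows from the others at the points where `ρ x ≠ 0`.)
The values of `u` at negative times play no role. -/
def IsSolution {N : ℕ} (J ρ h : EuclideanSpace ℝ (Fin N) → ℝ) (f : ℝ → ℝ)
    (u : ℝ → CRho ρ) : Prop :=
  ∀ t : ℝ, 0 ≤ t →
    (∃ g : CRho ρ, (∀ x, g x = nonlocalField J ρ h f (u t) x) ∧
      HasDerivWithinAt u g (Ici 0) t) ∧
    ∀ x, HasDerivWithinAt (fun s => u s x) (nonlocalField J ρ h f (u t) x) (Ici 0) t

/-- The semiflow `T(t)`, `t ≥ 0`, is generated by the evolution equation: the solutions on `[0, ∞)`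
are exactly the curves `t ↦ T(t) u₀`. -/
def IsGeneratedFlow {N : ℕ} (J ρ h : EuclideanSpace ℝ (Fin N) → ℝ) (f : ℝ → ℝ)
    (T : Flow ℝ≥0 (CRho ρ)) : Prop :=
  ∀ u : ℝ → CRho ρ, IsSolution J ρ h f u ↔ ∀ t : ℝ≥0, u t = T t (u 0)

/-- `B` absorbs every bounded set. -/
def IsAbsorbing {X : Type*} [PseudoMetricSpace X] (T : Flow ℝ≥0 X) (B : Set X) : Prop :=
  ∀ C : Set X, Bornology.IsBounded C →
    ∃ t₁ : ℝ≥0, 0 < t₁ ∧ ∀ t, t₁ ≤ t → T t '' C ⊆ B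

/-- Compact global attractors: compact invariant sets that attract every bounded set. -/
structure IsGlobalAttractor {X : Type*} [PseudoMetricSpace X] (T : Flow ℝ≥0 X)
    (A : Set X) : Prop where
  isCompact : IsCompact A
  invariant : ∀ t, T t '' A = A
  attracts : ∀ C : Set X, Bornology.IsBounded C → ∀ ε : ℝ, 0 < ε →
    ∃ t₀ : ℝ≥0, ∀ t, t₀ ≤ t → T t '' C ⊆ Metric.thickening ε A

end

/-! Write the equation as `u' = -u + ι F(u)`, where `F` is the integral operator plus `h`, with
values in the bounded continuous functions, and `ι` includes these in `CRho ρ`. The space `CRho ρ`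
is only seminormed and its completeness is never used, so the ODE is not solved there. The
substitution `u(t) = e^{-t} (u₀ + ι z(t))` moves it to the Banach space of bounded continuous
functions, where `z' = e^t F(u)`, `z(0) = 0` is globally Lipschitz; this gives the semiflow
(`exists_flow_of_lipschitzWith`).

Two facts produce the attractor. Compactness: since `f` is bounded, `J` and `ρ` are integrable and
`ρ` is bounded, `F` takes values in one compact convex set `S` (`isCompact_closure_kernelSet`). By
Hahn–Banach, `e^{-t} z(t)` lies in `(1 - e^{-t}) S`, so `T(t)u` is `e^{-t} u` plus an element of a
fixed compact set. Dissipation: `‖ι F(v)‖ ≤ a‖v‖ + b` with `a < 1` gives `‖T(t)u‖ ≤ b/(1-a) +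
e^{-(1-a)t}‖u‖` (`norm_exp_smul_le`), so balls of radius above `b/(1-a)` absorb.

The usual ω-limit argument then applies, except that limits are unique only up to vectors of norm
zero. Such vectors do not affect `z`, so the flow carries them along linearly, and exact invariance
can be recovered. -/

noncomputable section

/-! ### Compactness of families of Bochner integrals with bounded densities. -/

section WeightedIntegrals

/-- A set that can be approximated by compact sets to any accuracy is relatively compact. -/
theorem isCompact_closure_of_forall_approx {E : Type*} [PseudoMetricSpace E] [CompleteSpace E]
    {S : Set E} (H : ∀ ε > 0, ∃ Q : Set E, IsCompact Q ∧ ∀ s ∈ S, ∃ q ∈ Q, dist s q ≤ ε) :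
    IsCompact (closure S) := by
  refine isCompact_iff_totallyBounded_isComplete.2
    ⟨TotallyBounded.closure ?_, isClosed_closure.isComplete⟩
  refine Metric.totallyBounded_iff.2 fun ε hε => ?_
  obtain ⟨Q, hQ, hSQ⟩ := H (ε / 2) (by positivity)
  obtain ⟨t, ht, htQ⟩ := Metric.totallyBounded_iff.1 hQ.totallyBounded (ε / 2) (by positivity)
  refine ⟨t, ht, fun s hs => ?_⟩
  obtain ⟨q, hq, hsq⟩ := hSQ s hs
  obtain ⟨y, hy, hqy⟩ := mem_iUnion₂.1 (htQ hq)
  refine mem_iUnion₂.2 ⟨y, hy, ?_⟩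
  rw [Metric.mem_ball] at hqy ⊢
  linarith [dist_triangle s q y]

variable {E : Type*} [NormedAddCommGroup E] [NormedSpace ℝ E]
variable {Ω : Type*} [MeasurableSpace Ω]

/-- The integrals `∫ g • k` of a vector-valued function `k` against the densities `|g| ≤ M`. -/
def weightedIntegrals (μ : Measure Ω) (k : Ω → E) (M : ℝ) : Set E :=
  {w | ∃ g : Ω → ℝ, AEStronglyMeasurable g μ ∧ (∀ y, |g y| ≤ M) ∧ w = ∫ y, g y • k y ∂μ}

theorem integrable_weighted {μ : Measure Ω} {k : Ω → E} {M : ℝ} {g : Ω → ℝ}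
    (hk : Integrable k μ) (hg : AEStronglyMeasurable g μ) (hM : ∀ y, |g y| ≤ M) :
    Integrable (fun y => g y • k y) μ :=
  hk.bdd_smul M hg (Eventually.of_forall hM)

open Pointwise in
-- Induction on integrable `k`: for a constant on a set of finite measure the integrals fill part of
-- a segment, sums go to Minkowski sums, and an `L¹` change of `k` moves every integral by at most
-- `|M| ‖k - k'‖₁`.
theorem exists_isCompact_weightedIntegrals [CompleteSpace E] {μ : Measure Ω} {k : Ω → E}
    (hk : Integrable k μ) (M : ℝ) :
    ∃ Q : Set E, IsCompact Q ∧ weightedIntegrals μ k M ⊆ Q := by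
  refine Integrable.induction (fun k => ∃ Q : Set E, IsCompact Q ∧ weightedIntegrals μ k M ⊆ Q)
    ?_ ?_ ?_ ?_ hk
  · intro c s hs hμs
    refine ⟨(fun r : ℝ => r • c) '' Icc (-(M * μ.real s)) (M * μ.real s),
      isCompact_Icc.image (by fun_prop), ?_⟩
    rintro _ ⟨g, hg, hM, rfl⟩
    refine ⟨∫ y in s, g y ∂μ, ?_, ?_⟩
    · have := norm_setIntegral_le_of_norm_le_const hμs (f := g) (fun y _ => hM y)
      exact abs_le.1 this
    · have : ∀ y, g y • s.indicator (fun _ => c) y = s.indicator (fun y => g y • c) y := by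
        intro y
        by_cases hy : y ∈ s <;> simp [hy]
      simp only [this]
      rw [integral_indicator hs, integral_smul_const]
  · rintro k₁ k₂ - hk₁ hk₂ ⟨Q₁, hQ₁, h₁⟩ ⟨Q₂, hQ₂, h₂⟩
    refine ⟨Q₁ + Q₂, hQ₁.add hQ₂, ?_⟩
    rintro _ ⟨g, hg, hM, rfl⟩
    refine Set.mem_add.2 ⟨_, h₁ ⟨g, hg, hM, rfl⟩, _, h₂ ⟨g, hg, hM, rfl⟩, ?_⟩
    rw [← integral_add (integrable_weighted hk₁ hg hM) (integrable_weighted hk₂ hg hM)]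
    simp
  · refine isClosed_of_closure_subset fun k hk => ?_
    refine ⟨closure (weightedIntegrals μ k M), isCompact_closure_of_forall_approx fun ε hε => ?_,
      subset_closure⟩
    obtain ⟨k', ⟨Q, hQ, hk'⟩, hd⟩ := Metric.mem_closure_iff.1 hk (ε / (|M| + 1)) (by positivity)
    refine ⟨Q, hQ, ?_⟩
    rintro _ ⟨g, hg, hM, rfl⟩
    refine ⟨_, hk' ⟨g, hg, hM, rfl⟩, ?_⟩
    have hi := L1.integrable_coeFn k
    have hi' := L1.integrable_coeFn k'
    rw [dist_eq_norm, ← integral_sub (integrable_weighted hi hg hM) (integrable_weighted hi' hg hM)]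
    have hb : ‖∫ y, g y • k y - g y • k' y ∂μ‖ ≤ ∫ y, |M| * ‖k y - k' y‖ ∂μ := by
      refine norm_integral_le_of_norm_le ((hi.sub hi').norm.const_mul _)
        (Eventually.of_forall fun y => ?_)
      rw [← smul_sub, norm_smul]
      exact mul_le_mul_of_nonneg_right ((hM y).trans (le_abs_self M)) (norm_nonneg _)
    simp only [← dist_eq_norm (_ : E)] at hb
    rw [integral_const_mul, ← L1.dist_eq_integral_dist] at hb
    calc _ ≤ |M| * dist k k' := hb
      _ ≤ |M| * (ε / (|M| + 1)) := by gcongr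
      _ ≤ ε := by
        rw [mul_div_assoc', div_le_iff₀ (by positivity)]
        nlinarith [abs_nonneg M]
  · rintro k₁ k₂ h12 hk₁ ⟨Q, hQ, h⟩
    refine ⟨Q, hQ, ?_⟩
    rintro _ ⟨g, hg, hM, rfl⟩
    refine h ⟨g, hg, hM, integral_congr_ae ?_⟩
    filter_upwards [h12] with y hy
    rw [hy]

end WeightedIntegrals

/-! ### Compactness and continuity of the convolution operator. -/

section Kernel

open scoped BoundedContinuousFunction

variable {N : ℕ}

theorem integrable_kernel {J q : EuclideanSpace ℝ (Fin N) → ℝ} {M : ℝ} (hJ : Integrable J)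
    (hq : AEStronglyMeasurable q) (hM : ∀ y, |q y| ≤ M) (x : EuclideanSpace ℝ (Fin N)) :
    Integrable fun y => J (x - y) * q y :=
  (hJ.comp_sub_left x).mul_bdd hq (Eventually.of_forall hM)

theorem abs_integral_kernel_le {J q : EuclideanSpace ℝ (Fin N) → ℝ} {M : ℝ} (hJ : Integrable J)
    (hM : ∀ y, |q y| ≤ M) (x : EuclideanSpace ℝ (Fin N)) :
    |∫ y, J (x - y) * q y| ≤ (∫ y, |J y|) * M := by
  rw [← integral_sub_left_eq_self (fun y => |J y|) volume x, ← integral_mul_const]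
  rw [← Real.norm_eq_abs]
  refine norm_integral_le_of_norm_le ((hJ.comp_sub_left x).abs.mul_const M)
    (Eventually.of_forall fun y => ?_)
  rw [norm_mul]
  exact mul_le_mul_of_nonneg_left (hM y) (abs_nonneg _)

theorem abs_integral_kernel_sub_le {J φ q : EuclideanSpace ℝ (Fin N) → ℝ} {M : ℝ}
    (hJ : Integrable J) (hφ : Integrable φ) (hq : AEStronglyMeasurable q) (hM : ∀ y, |q y| ≤ M)
    (x : EuclideanSpace ℝ (Fin N)) :
    |(∫ y, J (x - y) * q y) - ∫ y, φ (x - y) * q y| ≤ (∫ y, |J y - φ y|) * M := by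
  rw [← integral_sub (integrable_kernel hJ hq hM x) (integrable_kernel hφ hq hM x)]
  simp only [← sub_mul]
  exact abs_integral_kernel_le (J := J - φ) (hJ.sub hφ) hM x

theorem continuous_integral_kernel_of_hasCompactSupport {φ q : EuclideanSpace ℝ (Fin N) → ℝ}
    (hφ : Continuous φ) (hφ' : HasCompactSupport φ) (hq : Integrable q) :
    Continuous fun x => ∫ y, φ (x - y) * q y := by
  obtain ⟨C, hC⟩ := hφ.bounded_above_of_compact_support hφ'
  refine continuous_of_dominated (bound := fun y => C * |q y|) (fun x => ?_) (fun x => ?_)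
    (hq.abs.const_mul C) (Eventually.of_forall fun y => by fun_prop)
  · exact (Continuous.aestronglyMeasurable (by fun_prop)).mul hq.aestronglyMeasurable
  · refine Eventually.of_forall fun y => ?_
    rw [norm_mul]
    exact mul_le_mul_of_nonneg_right (hC _) (abs_nonneg _)

/-- Approximating `J` in `L¹` by continuous compactly supported kernels makes the convolutions
converge uniformly, because `q` is bounded. -/
theorem continuous_integral_kernel {J q : EuclideanSpace ℝ (Fin N) → ℝ} {M : ℝ}
    (hJ : Integrable J) (hq : Integrable q) (hM : ∀ y, |q y| ≤ M) :
    Continuous fun x => ∫ y, J (x - y) * q y := by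
  refine continuous_of_uniform_approx_of_continuous fun U hU => ?_
  obtain ⟨ε, hε, hεU⟩ := Metric.mem_uniformity_dist.1 hU
  obtain ⟨φ, hφs, hφd, hφc, hφi⟩ :=
    hJ.exists_hasCompactSupport_integral_sub_le (ε := ε / (2 * (|M| + 1))) (by positivity)
  refine ⟨_, continuous_integral_kernel_of_hasCompactSupport hφc hφs hq, fun x => hεU ?_⟩
  rw [Real.dist_eq]
  refine (abs_integral_kernel_sub_le hJ hφi hq.aestronglyMeasurable
    (fun y => (hM y).trans (le_abs_self M)) x).trans_lt ?_
  calc _ ≤ ε / (2 * (|M| + 1)) * |M| := mul_le_mul_of_nonneg_right hφd (abs_nonneg M)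
    _ < ε := by
      rw [div_mul_eq_mul_div, div_lt_iff₀ (by positivity)]
      nlinarith [abs_nonneg M]

/-- The functions `x ↦ ∫ J (x - y) g(y) ρ(y) dy` with measurable `|g| ≤ M`. -/
def kernelSet (J ρ : EuclideanSpace ℝ (Fin N) → ℝ) (M : ℝ) :
    Set (EuclideanSpace ℝ (Fin N) →ᵇ ℝ) :=
  {w | ∃ g : EuclideanSpace ℝ (Fin N) → ℝ, AEStronglyMeasurable g ∧ (∀ y, |g y| ≤ M) ∧
    ∀ x, w x = ∫ y, J (x - y) * (g y * ρ y)}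

theorem abs_mul_le_of_bounds {g ρ : EuclideanSpace ℝ (Fin N) → ℝ} {M P : ℝ}
    (hM : ∀ y, |g y| ≤ M) (hP : ∀ y, |ρ y| ≤ P) (y : EuclideanSpace ℝ (Fin N)) :
    |g y * ρ y| ≤ M * P := by
  rw [abs_mul]
  exact mul_le_mul (hM y) (hP y) (abs_nonneg _) ((abs_nonneg _).trans (hM y))

theorem integrable_mul_weight {g ρ : EuclideanSpace ℝ (Fin N) → ℝ} {M : ℝ}
    (hρ : Integrable ρ) (hg : AEStronglyMeasurable g) (hM : ∀ y, |g y| ≤ M) :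
    Integrable fun y => g y * ρ y :=
  hρ.bdd_mul hg (Eventually.of_forall hM)

theorem convex_kernelSet {J ρ : EuclideanSpace ℝ (Fin N) → ℝ} {P : ℝ} (hJ : Integrable J)
    (hρ : Integrable ρ) (hP : ∀ y, |ρ y| ≤ P) (M : ℝ) : Convex ℝ (kernelSet J ρ M) := by
  rintro w₁ ⟨g₁, hg₁, hM₁, h₁⟩ w₂ ⟨g₂, hg₂, hM₂, h₂⟩ a b ha hb hab
  refine ⟨fun y => a * g₁ y + b * g₂ y, (hg₁.const_mul a).add (hg₂.const_mul b), fun y => ?_,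
    fun x => ?_⟩
  · calc |a * g₁ y + b * g₂ y| ≤ |a * g₁ y| + |b * g₂ y| := abs_add_le _ _
      _ = a * |g₁ y| + b * |g₂ y| := by rw [abs_mul, abs_mul, abs_of_nonneg ha, abs_of_nonneg hb]
      _ ≤ a * M + b * M := by gcongr <;> apply_assumption
      _ = M := by rw [← add_mul, hab, one_mul]
  · have i₁ := integrable_kernel hJ (hg₁.mul hρ.aestronglyMeasurable)
      (abs_mul_le_of_bounds hM₁ hP) x
    have i₂ := integrable_kernel hJ (hg₂.mul hρ.aestronglyMeasurable)
      (abs_mul_le_of_bounds hM₂ hP) x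
    change a * w₁ x + b * w₂ x = _
    rw [h₁, h₂, ← integral_const_mul, ← integral_const_mul,
      ← integral_add]
    rotate_left
    · exact i₁.const_mul a
    · exact i₂.const_mul b
    refine integral_congr_ae (Eventually.of_forall fun y => ?_)
    dsimp only
    ring

theorem continuous_translate {φ : EuclideanSpace ℝ (Fin N) →ᵇ ℝ} (hφ : UniformContinuous φ) :
    Continuous fun y => φ.compContinuous ⟨fun x => x - y, by fun_prop⟩ := by
  refine Metric.continuous_iff.2 fun y ε hε => ?_
  obtain ⟨δ, hδ, h⟩ := Metric.uniformContinuous_iff.1 hφ (ε / 2) (by positivity)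
  refine ⟨δ, hδ, fun z hz => ?_⟩
  refine ((BoundedContinuousFunction.dist_le (by positivity)).2 fun x => ?_).trans_lt
    (half_lt_self hε)
  exact (h (by simpa [dist_eq_norm, norm_sub_rev] using hz)).le

/-- Each such convolution is a Bochner integral, in the sup norm, of `g(y)` against the single
integrable map sending `y` to `ρ(y)` times the translate of `φ` by `y`. Uniform continuity of `φ`
makes translation norm-continuous, hence measurable. -/
theorem exists_isCompact_kernelSet_of_hasCompactSupport {φ ρ : EuclideanSpace ℝ (Fin N) → ℝ}
    (hφ : Continuous φ) (hφ' : HasCompactSupport φ) (hρ : Integrable ρ) (M : ℝ) :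
    ∃ Q : Set (EuclideanSpace ℝ (Fin N) →ᵇ ℝ), IsCompact Q ∧ kernelSet φ ρ M ⊆ Q := by
  obtain ⟨C, hC⟩ := hφ.bounded_above_of_compact_support hφ'
  let Φ : EuclideanSpace ℝ (Fin N) →ᵇ ℝ := BoundedContinuousFunction.ofNormedAddCommGroup φ hφ C hC
  have hΦ : UniformContinuous Φ := hφ'.uniformContinuous_of_continuous hφ
  have hcont := continuous_translate hΦ
  set τ := fun y : EuclideanSpace ℝ (Fin N) =>
    Φ.compContinuous ⟨fun x => x - y, by fun_prop⟩ with hτ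
  have hτn : ∀ y, ‖τ y‖ ≤ ‖Φ‖ := fun y =>
    (BoundedContinuousFunction.norm_le (norm_nonneg _)).2 fun x => Φ.norm_coe_le_norm _
  have hk : Integrable fun y => ρ y • τ y :=
    hρ.smul_bdd ‖Φ‖ hcont.aestronglyMeasurable (Eventually.of_forall hτn)
  obtain ⟨Q, hQ, h⟩ := exists_isCompact_weightedIntegrals hk M
  refine ⟨Q, hQ, ?_⟩
  rintro w ⟨g, hg, hM, hw⟩
  refine h ⟨g, hg, hM, ?_⟩
  ext x
  rw [hw]
  -- Evaluation at `x` is continuous and linear, so it turns the Bochner integral into the scalar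
  -- one.
  have := (BoundedContinuousFunction.evalCLM ℝ x).integral_comp_comm (integrable_weighted hk hg hM)
  change _ = BoundedContinuousFunction.evalCLM ℝ x _
  rw [← this]
  refine integral_congr_ae (Eventually.of_forall fun y => ?_)
  change φ (x - y) * (g y * ρ y) = g y * (ρ y * φ (x - y))
  ring

theorem isCompact_closure_kernelSet {J ρ : EuclideanSpace ℝ (Fin N) → ℝ} {P : ℝ}
    (hJ : Integrable J) (hρ : Integrable ρ) (hP : ∀ y, |ρ y| ≤ P) (M : ℝ) :
    IsCompact (closure (kernelSet J ρ M)) := by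
  refine isCompact_closure_of_forall_approx fun ε hε => ?_
  obtain ⟨φ, hφs, hφd, hφc, hφi⟩ :=
    hJ.exists_hasCompactSupport_integral_sub_le (ε := ε / (|M * P| + 1)) (by positivity)
  obtain ⟨Q, hQ, h⟩ := exists_isCompact_kernelSet_of_hasCompactSupport hφc hφs hρ M
  refine ⟨Q, hQ, ?_⟩
  rintro w ⟨g, hg, hM, hw⟩
  have hb := abs_mul_le_of_bounds hM hP
  let v : EuclideanSpace ℝ (Fin N) →ᵇ ℝ := BoundedContinuousFunction.ofNormedAddCommGroup _
    (continuous_integral_kernel_of_hasCompactSupport hφc hφs (integrable_mul_weight hρ hg hM)) _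
    (abs_integral_kernel_le hφi hb)
  refine ⟨v, h ⟨g, hg, hM, fun x => rfl⟩, ?_⟩
  refine (BoundedContinuousFunction.dist_le hε.le).2 fun x => ?_
  rw [Real.dist_eq, hw]
  refine (abs_integral_kernel_sub_le hJ hφi (hg.mul hρ.aestronglyMeasurable)
    (fun y => (hb y).trans (le_abs_self _)) x).trans ?_
  calc _ ≤ ε / (|M * P| + 1) * |M * P| := mul_le_mul_of_nonneg_right hφd (abs_nonneg _)
    _ ≤ ε := by
      rw [div_mul_eq_mul_div, div_le_iff₀ (by positivity)]
      nlinarith [abs_nonneg (M * P)]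

end Kernel

/-! ### Global solutions and the semiflow of `u' = -u + ι F(u)`. -/

section Duhamel

variable {Y : Type*} [SeminormedAddCommGroup Y] [NormedSpace ℝ Y]
  {E : Type*} [NormedAddCommGroup E] [NormedSpace ℝ E]

/-- After the substitution `u(t) = e^{-t} (u₀ + ι z(t))` the equation `u' = -u + ι F(u)` becomes
`z' = duhamelField ι F u₀ t z`. -/
def duhamelField (ι : E →L[ℝ] Y) (F : Y → E) (u₀ : Y) (t : ℝ) (z : E) : E :=
  Real.exp t • F (Real.exp (-t) • (u₀ + ι z))

/-- `z` solves `z' = duhamelField ι F u₀ t z`, `z(0) = 0`, on `[0, ∞)`. -/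
def IsDuhamelSolution (ι : E →L[ℝ] Y) (F : Y → E) (u₀ : Y) (z : ℝ → E) : Prop :=
  z 0 = 0 ∧ ∀ t, 0 ≤ t → HasDerivWithinAt z (duhamelField ι F u₀ t (z t)) (Ici 0) t

variable {ι : E →L[ℝ] Y} {F : Y → E} {L : ℝ≥0}

/-- The factors `e^t` and `e^{-t}` cancel, so the Lipschitz constant does not depend on time. -/
theorem norm_duhamelField_sub_le (hF : LipschitzWith L F) (u v : Y) (t : ℝ) (z w : E) :
    ‖duhamelField ι F u t z - duhamelField ι F v t w‖ ≤ L * ‖(u - v) + ι (z - w)‖ := by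
  have h := hF.norm_sub_le (Real.exp (-t) • (u + ι z)) (Real.exp (-t) • (v + ι w))
  rw [← smul_sub, norm_smul, Real.norm_eq_abs, Real.abs_exp] at h
  rw [duhamelField, duhamelField, ← smul_sub, norm_smul, Real.norm_eq_abs, Real.abs_exp]
  calc _ ≤ Real.exp t * (L * (Real.exp (-t) * ‖u + ι z - (v + ι w)‖)) := by gcongr
    _ = (Real.exp t * Real.exp (-t)) * (L * ‖u + ι z - (v + ι w)‖) := by ring
    _ = L * ‖(u - v) + ι (z - w)‖ := by
      rw [← Real.exp_add, add_neg_cancel, Real.exp_zero, one_mul, map_sub, add_sub_add_comm]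

theorem lipschitzWith_duhamelField (hF : LipschitzWith L F) (u : Y) (t : ℝ) :
    LipschitzWith (L * ‖ι‖₊) (duhamelField ι F u t) := by
  refine LipschitzWith.of_dist_le_mul fun z w => ?_
  rw [dist_eq_norm, dist_eq_norm]
  refine (norm_duhamelField_sub_le hF u u t z w).trans ?_
  rw [sub_self, zero_add, NNReal.coe_mul, mul_assoc]
  exact mul_le_mul_of_nonneg_left (ι.le_opNorm _) L.2

theorem continuous_duhamelField (hF : LipschitzWith L F) (u : Y) (z : E) :
    Continuous fun t => duhamelField ι F u t z := by
  have := hF.continuous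
  unfold duhamelField
  fun_prop

namespace IsDuhamelSolution

theorem continuousOn {u : Y} {z : ℝ → E} (hz : IsDuhamelSolution ι F u z) :
    ContinuousOn z (Ici 0) :=
  fun t ht => (hz.2 t ht).continuousWithinAt

theorem hasDerivWithinAt_Ici {u : Y} {z : ℝ → E} (hz : IsDuhamelSolution ι F u z) {t : ℝ}
    (ht : 0 ≤ t) : HasDerivWithinAt z (duhamelField ι F u t (z t)) (Ici t) t :=
  (hz.2 t ht).mono (Ici_subset_Ici.2 ht)

/-- Gronwall: `z` solves the equation of `w` up to an error `L * ‖u - v‖`, and both start at `0`. -/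
theorem norm_sub_le (hF : LipschitzWith L F) {u v : Y} {z w : ℝ → E}
    (hz : IsDuhamelSolution ι F u z) (hw : IsDuhamelSolution ι F v w) {t : ℝ} (ht : 0 ≤ t) :
    ‖z t - w t‖ ≤ gronwallBound 0 (L * ‖ι‖₊ : ℝ≥0) (L * ‖u - v‖) t := by
  have h := dist_le_of_approx_trajectories_ODE (v := duhamelField ι F v) (f := z) (g := w)
    (a := 0) (b := t) (δ := 0) (εf := L * ‖u - v‖) (εg := 0)
    (fun s => lipschitzWith_duhamelField hF v s)
    (hz.continuousOn.mono Icc_subset_Ici_self) (fun s hs => hz.hasDerivWithinAt_Ici hs.1)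
    (fun s _ => ?_) (hw.continuousOn.mono Icc_subset_Ici_self)
    (fun s hs => hw.hasDerivWithinAt_Ici hs.1) (fun s _ => by simp) (by simp [hz.1, hw.1])
    t ⟨ht, le_rfl⟩
  · simpa [dist_eq_norm] using h
  · rw [dist_eq_norm]
    simpa using norm_duhamelField_sub_le (ι := ι) hF u v s (z s) (z s)

theorem eq_of_norm_sub_eq_zero (hF : LipschitzWith L F) {u v : Y} {z w : ℝ → E}
    (hz : IsDuhamelSolution ι F u z) (hw : IsDuhamelSolution ι F v w) (huv : ‖u - v‖ = 0)
    {t : ℝ} (ht : 0 ≤ t) : z t = w t := by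
  have h := norm_sub_le hF hz hw ht
  rw [huv, mul_zero, gronwallBound_ε0_δ0] at h
  exact sub_eq_zero.1 (norm_le_zero_iff.1 h)

/-- Restarting at time `s`; with uniqueness this yields the semigroup law. -/
theorem shift {u : Y} {z : ℝ → E} (hz : IsDuhamelSolution ι F u z) {s : ℝ} (hs : 0 ≤ s) :
    IsDuhamelSolution ι F (Real.exp (-s) • (u + ι (z s)))
      fun t => Real.exp (-s) • (z (t + s) - z s) := by
  refine ⟨by simp, fun t ht => ?_⟩
  have h1 : HasDerivWithinAt (fun t => z (t + s)) (duhamelField ι F u (t + s) (z (t + s)))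
      (Ici 0) t := by
    have := (hz.2 (t + s) (by positivity)).scomp t
      ((hasDerivAt_id t).add_const s).hasDerivWithinAt (s := Ici 0)
      (fun x hx => add_nonneg (mem_Ici.1 hx) hs)
    simpa [Function.comp_def] using this
  convert (h1.sub_const (z s)).const_smul (Real.exp (-s)) using 1
  · rfl
  simp only [duhamelField, smul_smul, ← Real.exp_add, map_smul, map_sub, ← smul_add]
  rw [neg_add, add_comm t s, neg_add_cancel_left, add_comm (-t) (-s), add_assoc,
    add_sub_cancel]

end IsDuhamelSolution

variable [CompleteSpace E]

theorem exists_hasDerivWithinAt_Icc_duhamelField (hF : LipschitzWith L F) {M : ℝ}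
    (hM : ∀ u, ‖F u‖ ≤ M) (u : Y) {b : ℝ} (hb : 0 ≤ b) :
    ∃ z : ℝ → E, z 0 = 0 ∧
      ∀ t ∈ Icc 0 b, HasDerivWithinAt z (duhamelField ι F u t (z t)) (Icc 0 b) t := by
  have hM0 : 0 ≤ M := (norm_nonneg _).trans (hM 0)
  -- The field is bounded by `e^b M` on `[0, b]`, so a ball of radius `e^b M b` cannot be left and
  -- the solution exists on the whole interval.
  have hPL : IsPicardLindelof (duhamelField ι F u) (tmin := 0) (tmax := b)
      ⟨0, le_rfl, hb⟩ 0 (⟨Real.exp b * M, by positivity⟩ * ⟨b, hb⟩) 0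
      ⟨Real.exp b * M, by positivity⟩ (L * ‖ι‖₊) := by
    refine ⟨fun t _ => (lipschitzWith_duhamelField hF u t).lipschitzOnWith,
      fun z _ => (continuous_duhamelField hF u z).continuousOn, fun t ht z _ => ?_, ?_⟩
    · rw [duhamelField, norm_smul, Real.norm_eq_abs, Real.abs_exp]
      change _ ≤ Real.exp b * M
      gcongr
      exacts [ht.2, hM _]
    · change Real.exp b * M * max (b - 0) (0 - 0) ≤ Real.exp b * M * b - 0
      simp [hb]
  exact hPL.exists_eq_forall_mem_Icc_hasDerivWithinAt₀

theorem exists_isDuhamelSolution (hF : LipschitzWith L F) {M : ℝ}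
    (hM : ∀ u, ‖F u‖ ≤ M) (u : Y) : ∃ z : ℝ → E, IsDuhamelSolution ι F u z := by
  choose z hz0 hz using fun n : ℕ =>
    exists_hasDerivWithinAt_Icc_duhamelField (ι := ι) hF hM u (Nat.cast_nonneg n)
  have hcont : ∀ n, ContinuousOn (z n) (Icc 0 n) := fun n t ht => (hz n t ht).continuousWithinAt
  have hder : ∀ n : ℕ, ∀ t ∈ Ico (0 : ℝ) n,
      HasDerivWithinAt (z n) (duhamelField ι F u t (z n t)) (Ici t) t := fun n t ht =>
    (hz n t (Ico_subset_Icc_self ht)).mono_of_mem_nhdsWithin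
      (mem_of_superset (Icc_mem_nhdsGE ht.2) (Icc_subset_Icc_left ht.1))
  have heq : ∀ m n : ℕ, m ≤ n → EqOn (z m) (z n) (Icc 0 m) := fun m n hmn => by
    have hmn' : (m : ℝ) ≤ n := by exact_mod_cast hmn
    exact ODE_solution_unique_of_mem_Icc_right (v := duhamelField ι F u) (s := fun _ => univ)
      (fun t _ => (lipschitzWith_duhamelField hF u t).lipschitzOnWith) (hcont m) (hder m)
      (fun _ _ => mem_univ _) ((hcont n).mono (Icc_subset_Icc_right hmn'))
      (fun t ht => hder n t ⟨ht.1, ht.2.trans_le hmn'⟩) (fun _ _ => mem_univ _)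
      ((hz0 m).trans (hz0 n).symm)
  -- By uniqueness the solutions on `[0, n]` agree, so the one with index `⌈t⌉₊` defines the global
  -- solution at `t`.
  have hglue : ∀ n : ℕ, ∀ t ∈ Icc (0 : ℝ) n, z ⌈t⌉₊ t = z n t := fun n t ht =>
    heq _ _ (Nat.ceil_le.2 ht.2) ⟨ht.1, Nat.le_ceil t⟩
  refine ⟨fun t => z ⌈t⌉₊ t, by simpa using hz0 0, fun t ht => ?_⟩
  obtain ⟨n, hn⟩ := exists_nat_gt t
  have h1 := (hz n t ⟨ht, hn.le⟩).congr_of_mem (f₁ := fun t => z ⌈t⌉₊ t) (hglue n) ⟨ht, hn.le⟩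
  rw [← hglue n t ⟨ht, hn.le⟩] at h1
  refine h1.mono_of_mem_nhdsWithin ?_
  rw [← Ici_inter_Iic]
  exact inter_mem self_mem_nhdsWithin (mem_nhdsWithin_of_mem_nhds (Iic_mem_nhds hn))

/-- The semiflow of `u' = -u + ι F(u)`. -/
theorem exists_flow_of_lipschitzWith (ι : E →L[ℝ] Y) (hF : LipschitzWith L F) {M : ℝ}
    (hM : ∀ u, ‖F u‖ ≤ M) :
    ∃ (T : Flow ℝ≥0 Y) (z : Y → ℝ → E), (∀ u, IsDuhamelSolution ι F u (z u)) ∧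
      ∀ (t : ℝ≥0) u, T t u = Real.exp (-t) • (u + ι (z u t)) := by
  choose z hz using exists_isDuhamelSolution (ι := ι) hF hM
  have hzc : Continuous fun p : ℝ≥0 × Y => z p.2 p.1 := by
    refine continuous_iff_continuousAt.2 fun ⟨t, u⟩ => ?_
    have h1 : Tendsto (fun p : ℝ≥0 × Y => z u p.1) (𝓝 (t, u)) (𝓝 (z u t)) := by
      have h := (hz u).continuousOn.comp_continuous NNReal.continuous_coe (fun s => s.2)
      exact (h.comp continuous_fst).tendsto (t, u)
    have h2 : Tendsto (fun p : ℝ≥0 × Y => z p.2 p.1 - z u p.1) (𝓝 (t, u)) (𝓝 0) := by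
      have hg : Continuous fun p : ℝ≥0 × Y =>
          gronwallBound 0 (L * ‖ι‖₊ : ℝ≥0) (L * ‖p.2 - u‖) p.1 := by
        unfold gronwallBound
        split_ifs <;> fun_prop
      refine squeeze_zero_norm (fun p => IsDuhamelSolution.norm_sub_le hF (hz _) (hz _) p.1.2) ?_
      simpa [gronwallBound_ε0_δ0] using hg.tendsto (t, u)
    simpa [ContinuousAt] using h2.add h1
  refine ⟨⟨fun t u => Real.exp (-t) • (u + ι (z u t)), ?_, ?_, ?_⟩, z, hz, fun t u => rfl⟩
  · change Continuous fun p : ℝ≥0 × Y => Real.exp (-p.1) • (p.2 + ι (z p.2 p.1))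
    have h : Continuous fun p : ℝ≥0 × Y => Real.exp (-p.1) := by fun_prop
    exact h.smul (continuous_snd.add (ι.continuous.comp hzc))
  · intro t s u
    have h := IsDuhamelSolution.eq_of_norm_sub_eq_zero hF (hz (Real.exp (-s) • (u + ι (z u s))))
      ((hz u).shift s.coe_nonneg) (by rw [sub_self, norm_zero]) t.coe_nonneg
    rw [h, NNReal.coe_add, map_smul, map_sub, ← smul_add, smul_smul, ← Real.exp_add]
    rw [neg_add, add_assoc, add_sub_cancel]
  · intro u
    simp [(hz u).1]

end Duhamel

/-! ### Dissipative bound and compact confinement of solutions. -/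

section DuhamelEstimates

variable {Y : Type*} [SeminormedAddCommGroup Y] [NormedSpace ℝ Y]
  {E : Type*} [NormedAddCommGroup E] [NormedSpace ℝ E] {ι : E →L[ℝ] Y} {F : Y → E}
  {u : Y} {z : ℝ → E}

namespace IsDuhamelSolution

/-- Comparison with the barrier `B(s) = e^s (b + ε)/(1 - a) + e^{as}‖u‖`, which solves `B' = aB +
e^s (b + ε)`. The `ε` provides the strict inequality at contact and is then sent to `0`. -/
theorem norm_add_le (hz : IsDuhamelSolution ι F u z) {a b : ℝ} (ha : a < 1)
    (hF : ∀ v, ‖ι (F v)‖ ≤ a * ‖v‖ + b) {t : ℝ} (ht : 0 ≤ t) :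
    ‖u + ι (z t)‖ ≤ Real.exp t * (b / (1 - a)) + Real.exp (a * t) * ‖u‖ := by
  have h1a : 0 < 1 - a := by linarith
  have key : ∀ ε > 0, ‖u + ι (z t)‖ ≤
      Real.exp t * ((b + ε) / (1 - a)) + Real.exp (a * t) * ‖u‖ := by
    intro ε hε
    -- The comparison is made in the separation quotient, a genuine normed space with the same
    -- norms.
    let p : E →L[ℝ] SeparationQuotient Y := (SeparationQuotient.mkCLM ℝ Y).comp ι
    have hn : ∀ s, ‖SeparationQuotient.mk u + p (z s)‖ = ‖u + ι (z s)‖ := fun s =>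
      SeparationQuotient.norm_mk (u + ι (z s))
    have hp : ∀ e, ‖p e‖ = ‖ι e‖ := fun e => SeparationQuotient.norm_mk (ι e)
    have hb : b ≥ 0 := by
      have := (norm_nonneg _).trans (hF 0)
      simpa using this
    have h := image_norm_le_of_norm_deriv_right_lt_deriv_boundary (a := 0) (b := t)
      (f := fun s => SeparationQuotient.mk u + p (z s))
      (f' := fun s => p (duhamelField ι F u s (z s)))
      (B := fun s => Real.exp s * ((b + ε) / (1 - a)) + Real.exp (a * s) * ‖u‖)
      (B' := fun s => Real.exp s * ((b + ε) / (1 - a)) + Real.exp (a * s) * a * ‖u‖)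
      (continuousOn_const.add (p.continuous.comp_continuousOn
        (hz.continuousOn.mono Icc_subset_Ici_self)))
      (fun s hs => (p.hasFDerivAt.comp_hasDerivWithinAt s
        (hz.hasDerivWithinAt_Ici hs.1)).const_add _) ?_ ?_ ?_ ⟨ht, le_rfl⟩
    · rwa [hn] at h
    · rw [hn, hz.1, map_zero, add_zero, mul_zero, Real.exp_zero, one_mul, one_mul]
      have : 0 ≤ (b + ε) / (1 - a) := by positivity
      linarith
    · intro s
      have h2 := ((hasDerivAt_id s).const_mul a).exp
      simp only [id, mul_one] at h2
      exact ((Real.hasDerivAt_exp s).mul_const _).add (h2.mul_const _)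
    · intro s _ hs
      rw [hn] at hs
      rw [hp, duhamelField, map_smul, norm_smul, Real.norm_eq_abs, Real.abs_exp]
      have h3 := hF (Real.exp (-s) • (u + ι (z s)))
      rw [norm_smul, Real.norm_eq_abs, Real.abs_exp, hs] at h3
      have h4 := mul_le_mul_of_nonneg_left h3 (Real.exp_pos s).le
      have h5 : Real.exp s * Real.exp (-s) = 1 := by
        rw [← Real.exp_add, add_neg_cancel, Real.exp_zero]
      have h6 : Real.exp s * ((b + ε) / (1 - a)) =
          a * (Real.exp s * ((b + ε) / (1 - a))) + Real.exp s * (b + ε) := by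
        field_simp
        ring
      have h7 := mul_pos (Real.exp_pos s) hε
      have h8 : ∀ B : ℝ, Real.exp s * (a * (Real.exp (-s) * B) + b) = a * B + Real.exp s * b :=
        fun B => by linear_combination (a * B) * h5
      rw [h8] at h4
      linarith
  have hlim : Tendsto (fun ε : ℝ => Real.exp t * ((b + ε) / (1 - a)) + Real.exp (a * t) * ‖u‖)
      (𝓝[>] 0) (𝓝 (Real.exp t * ((b + 0) / (1 - a)) + Real.exp (a * t) * ‖u‖)) := by
    refine Tendsto.mono_left ?_ nhdsWithin_le_nhds
    exact Continuous.tendsto (by fun_prop) 0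
  rw [add_zero] at hlim
  exact ge_of_tendsto hlim (eventually_nhdsWithin_of_forall key)

theorem norm_exp_smul_le (hz : IsDuhamelSolution ι F u z) {a b : ℝ} (ha : a < 1)
    (hF : ∀ v, ‖ι (F v)‖ ≤ a * ‖v‖ + b) {t : ℝ} (ht : 0 ≤ t) :
    ‖Real.exp (-t) • (u + ι (z t))‖ ≤ b / (1 - a) + Real.exp (-(1 - a) * t) * ‖u‖ := by
  rw [norm_smul, Real.norm_eq_abs, Real.abs_exp]
  refine (mul_le_mul_of_nonneg_left (norm_add_le hz ha hF ht) (Real.exp_pos _).le).trans_eq ?_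
  rw [mul_add, ← mul_assoc, ← mul_assoc, ← Real.exp_add, ← Real.exp_add, neg_add_cancel,
    Real.exp_zero, one_mul]
  ring_nf

/-- If `F` takes values in a closed convex set `S` then `e^{-t} z(t) ∈ (1 - e^{-t}) S`. -/
theorem exists_mem_eq_smul (hz : IsDuhamelSolution ι F u z) {S : Set E} (hS : Convex ℝ S)
    (hSc : IsClosed S) (hFS : ∀ v, F v ∈ S) {t : ℝ} (ht : 0 ≤ t) :
    ∃ s ∈ S, Real.exp (-t) • z t = (1 - Real.exp (-t)) • s := by
  rcases ht.eq_or_lt with rfl | ht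
  · exact ⟨F u, hFS u, by simp [hz.1]⟩
  have hpos : 0 < Real.exp t - 1 := by linarith [Real.add_one_lt_exp ht.ne']
  -- Since `z' = e^s F(u)` and `∫₀ᵗ e^s ds = e^t - 1`, this vector is a weighted average of values
  -- of `F`. If it were outside `S`, a separating functional bounded by `c` on `S` would violate the
  -- integrated inequality.
  suffices h : (Real.exp t - 1)⁻¹ • z t ∈ S by
    refine ⟨_, h, ?_⟩
    rw [smul_smul]
    congr 1
    rw [Real.exp_neg]
    have := Real.exp_pos t
    field_simp
  by_contra hcon
  obtain ⟨g, c, hgS, hgc⟩ := geometric_hahn_banach_closed_point hS hSc hcon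
  have h := image_le_of_deriv_right_le_deriv_boundary (a := 0) (b := t)
    (f := fun s => g (z s)) (f' := fun s => g (duhamelField ι F u s (z s)))
    (B := fun s => (Real.exp s - 1) * c) (B' := fun s => Real.exp s * c)
    (g.continuous.comp_continuousOn (hz.continuousOn.mono Icc_subset_Ici_self))
    (fun s hs => g.hasFDerivAt.comp_hasDerivWithinAt s (hz.hasDerivWithinAt_Ici hs.1))
    (by simp [hz.1]) (by fun_prop)
    (fun s _ => (((Real.hasDerivAt_exp s).sub_const 1).mul_const c).hasDerivWithinAt)
    (fun s _ => ?_) ⟨ht.le, le_rfl⟩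
  · rw [map_smul, smul_eq_mul, lt_inv_mul_iff₀ hpos] at hgc
    exact absurd h (not_le.2 hgc)
  · rw [duhamelField, map_smul, smul_eq_mul]
    exact mul_le_mul_of_nonneg_left (hgS _ (hFS _)).le (Real.exp_pos s).le

end IsDuhamelSolution

/-- If `F` takes values in a compact convex set then `e^{-t} (u + ι z(t))` differs from `e^{-t} u`
by an element of a fixed compact set. -/
theorem exists_isCompact_duhamel (ι : E →L[ℝ] Y) {S : Set E} (hS : Convex ℝ S) (hSc : IsCompact S)
    (hFS : ∀ v, F v ∈ S) :
    ∃ Q : Set Y, IsCompact Q ∧ ∀ u z, IsDuhamelSolution ι F u z → ∀ t, 0 ≤ t →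
      ∃ q ∈ Q, Real.exp (-t) • (u + ι (z t)) = Real.exp (-t) • u + q := by
  refine ⟨(fun p : ℝ × E => ι (p.1 • p.2)) '' (Icc 0 1 ×ˢ S),
    (isCompact_Icc.prod hSc).image (by fun_prop), fun u z hz t ht => ?_⟩
  obtain ⟨s, hs, h⟩ := hz.exists_mem_eq_smul hS hSc.isClosed hFS ht
  refine ⟨_, ⟨(1 - Real.exp (-t), s), ⟨⟨?_, ?_⟩, hs⟩, rfl⟩, ?_⟩
  · simpa using ht
  · linarith [Real.exp_pos (-t)]
  · rw [smul_add, ← map_smul, h]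

end DuhamelEstimates

/-! ### Global attractors of asymptotically compact semiflows on seminormed spaces. -/

section Attractor

variable {Y : Type*} [SeminormedAddCommGroup Y]

theorem mem_omegaLimit_of_tendsto {T : Flow ℝ≥0 Y} {B : Set Y} {t : ℕ → ℝ≥0} {u : ℕ → Y} {p : Y}
    (ht : Tendsto t atTop atTop) (hu : ∀ n, u n ∈ B)
    (hp : Tendsto (fun n => T (t n) (u n)) atTop (𝓝 p)) : p ∈ omegaLimit atTop T B := by
  refine (mem_omegaLimit_iff_frequently _ _ _ _).2 fun V hV => ?_
  refine ht.frequently (Eventually.frequently ?_)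
  filter_upwards [hp hV] with n hn
  exact ⟨u n, hu n, hn⟩

theorem exists_seq_of_mem_omegaLimit {T : Flow ℝ≥0 Y} {B : Set Y} {p : Y}
    (hp : p ∈ omegaLimit atTop T B) :
    ∃ (t : ℕ → ℝ≥0) (u : ℕ → Y), Tendsto t atTop atTop ∧ (∀ n, u n ∈ B) ∧
      Tendsto (fun n => T (t n) (u n)) atTop (𝓝 p) := by
  have h : ∀ n : ℕ, ∃ t : ℝ≥0, (n : ℝ≥0) ≤ t ∧ ∃ u ∈ B, dist (T t u) p < 1 / ((n : ℝ) + 1) := by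
    intro n
    have := (mem_omegaLimit_iff_frequently _ _ _ _).1 hp _
      (Metric.ball_mem_nhds p (Nat.one_div_pos_of_nat (n := n)))
    obtain ⟨t, ⟨u, hu, hd⟩, ht⟩ := (this.and_eventually (eventually_ge_atTop (n : ℝ≥0))).exists
    exact ⟨t, ht, u, hu, hd⟩
  choose t ht u hu hd using h
  refine ⟨t, u, tendsto_atTop_mono ht tendsto_natCast_atTop_atTop, hu, ?_⟩
  exact tendsto_iff_dist_tendsto_zero.2 (squeeze_zero (fun n => dist_nonneg)
    (fun n => (hd n).le) tendsto_one_div_add_atTop_nhds_zero_nat)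

theorem omegaLimit_subset_of_isAbsorbing {T : Flow ℝ≥0 Y} {B : Set Y}
    (hB : Bornology.IsBounded B) (hBc : IsClosed B) (habs : IsAbsorbing T B) :
    omegaLimit atTop T B ⊆ B := by
  obtain ⟨t₁, -, h⟩ := habs B hB
  refine (omegaLimit_subset_closure_image2 _ _ _ (Ici_mem_atTop t₁)).trans
    (closure_minimal ?_ hBc)
  rintro _ ⟨t, ht, u, hu, rfl⟩
  exact h t ht ⟨u, hu, rfl⟩

/-- A dissipative estimate makes every ball of sufficiently large radius absorbing. -/
theorem isAbsorbing_closedBall {T : Flow ℝ≥0 Y} {a r R : ℝ} (ha : a < 1)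
    (hT : ∀ (t : ℝ≥0) u, ‖T t u‖ ≤ r + Real.exp (-(1 - a) * t) * ‖u‖) (hR : r < R) :
    IsAbsorbing T (Metric.closedBall 0 R) := by
  intro C hC
  obtain ⟨M, hM⟩ := hC.exists_norm_le
  have hlim : Tendsto (fun t : ℝ≥0 => r + Real.exp (-(1 - a) * t) * M) atTop (𝓝 (r + 0 * M)) := by
    refine (Tendsto.mul_const M ?_).const_add r
    refine Real.tendsto_exp_atBot.comp ?_
    exact (NNReal.tendsto_coe_atTop.2 tendsto_id).const_mul_atTop_of_neg (by linarith)
  have hev := hlim.eventually (gt_mem_nhds (show r + 0 * M < R by simpa using hR))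
  obtain ⟨t₁, h₁⟩ := eventually_atTop.1 hev
  refine ⟨t₁ + 1, by positivity, fun t ht => ?_⟩
  rintro _ ⟨u, hu, rfl⟩
  rw [mem_closedBall_zero_iff]
  have h2 := h₁ t ((le_add_of_nonneg_right zero_le_one).trans ht)
  refine (hT t u).trans (le_trans ?_ h2.le)
  gcongr
  exact hM u hu

variable [NormedSpace ℝ Y]

/-- The semiflow is, up to the exponentially small term `e^{-t} u`, confined to the set `Q`, and
vectors of norm zero only enter through that term. -/
structure IsCompactPerturbation (T : Flow ℝ≥0 Y) (Q : Set Y) : Prop where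
  exists_mem : ∀ (t : ℝ≥0) u, ∃ q ∈ Q, T t u = Real.exp (-t) • u + q
  map_add : ∀ (t : ℝ≥0) u m, ‖m‖ = 0 → T t (u + m) = T t u + Real.exp (-t) • m

theorem tendsto_exp_neg_smul {t : ℕ → ℝ≥0} (ht : Tendsto t atTop atTop) {C : Set Y}
    (hC : Bornology.IsBounded C) {u : ℕ → Y} (hu : ∀ n, u n ∈ C) :
    Tendsto (fun n => Real.exp (-(t n : ℝ)) • u n) atTop (𝓝 0) := by
  obtain ⟨r, hr⟩ := hC.exists_norm_le
  refine squeeze_zero_norm (a := fun n => Real.exp (-(t n : ℝ)) * r) (fun n => ?_) ?_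
  · rw [norm_smul, Real.norm_eq_abs, Real.abs_exp]
    exact mul_le_mul_of_nonneg_left (hr _ (hu n)) (Real.exp_pos _).le
  · have h := Real.tendsto_exp_neg_atTop_nhds_zero.comp (NNReal.tendsto_coe_atTop.2 ht)
    simpa using h.mul_const r

namespace IsCompactPerturbation

variable {T : Flow ℝ≥0 Y} {Q : Set Y}

/-- Asymptotic compactness: the term `e^{-t} u` vanishes along bounded data, and the rest stays in a
compact set. -/
theorem exists_tendsto (hT : IsCompactPerturbation T Q) (hQ : IsCompact Q) {t : ℕ → ℝ≥0}
    (ht : Tendsto t atTop atTop) {C : Set Y} (hC : Bornology.IsBounded C) {u : ℕ → Y}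
    (hu : ∀ n, u n ∈ C) :
    ∃ q ∈ Q, ∃ φ : ℕ → ℕ, StrictMono φ ∧ Tendsto (fun n => T (t (φ n)) (u (φ n))) atTop (𝓝 q) := by
  choose q hq h using fun n => hT.exists_mem (t n) (u n)
  obtain ⟨q₀, hq₀, φ, hφ, hlim⟩ := hQ.tendsto_subseq hq
  refine ⟨q₀, hq₀, φ, hφ, ?_⟩
  simp only [h]
  simpa using ((tendsto_exp_neg_smul ht hC hu).comp hφ.tendsto_atTop).add hlim

theorem isCompact_omegaLimit (hT : IsCompactPerturbation T Q) (hQ : IsCompact Q) {B : Set Y}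
    (hB : Bornology.IsBounded B) : IsCompact (omegaLimit atTop T B) := by
  refine hQ.closure.of_isClosed_subset (isClosed_omegaLimit _ _ _) fun p hp => ?_
  obtain ⟨t, u, ht, hu, hlim⟩ := exists_seq_of_mem_omegaLimit hp
  obtain ⟨q, hq, φ, hφ, h⟩ := hT.exists_tendsto hQ ht hB hu
  have hpq : Inseparable p q := tendsto_nhds_unique_inseparable (hlim.comp hφ.tendsto_atTop) h
  exact (hpq.mem_closed_iff isClosed_closure).2 (subset_closure hq)

/-- A closed set that is mapped into itself, and onto itself up to inseparability, is invariant. -/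
theorem image_eq_of_inseparable (hT : IsCompactPerturbation T Q) {A : Set Y} (hA : IsClosed A)
    {t : ℝ≥0} (h₁ : T t '' A ⊆ A) (h₂ : ∀ p ∈ A, ∃ q ∈ A, Inseparable (T t q) p) :
    T t '' A = A := by
  refine h₁.antisymm fun p hp => ?_
  obtain ⟨q, hq, hqp⟩ := h₂ p hp
  have hm : ‖p - T t q‖ = 0 := by
    rw [← dist_eq_norm, dist_comm]
    exact Metric.inseparable_iff.1 hqp
  have hm' : ‖Real.exp t • (p - T t q)‖ = 0 := by rw [norm_smul, hm, mul_zero]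
  -- The defect `p - T t q` has norm zero and the flow multiplies such vectors by `e^{-t}`, so
  -- adding `e^t` times the defect to `q` gives an exact preimage. It stays in the closed set `A`,
  -- being inseparable from `q`.
  refine ⟨q + Real.exp t • (p - T t q), ?_, ?_⟩
  · have : Inseparable (q + Real.exp t • (p - T t q)) q := by
      rw [Metric.inseparable_iff, dist_eq_norm, add_sub_cancel_left, hm']
    exact (this.mem_closed_iff hA).2 hq
  · rw [hT.map_add t q _ hm', smul_smul, ← Real.exp_add, neg_add_cancel, Real.exp_zero, one_smul,
      add_sub_cancel]

theorem isGlobalAttractor_omegaLimit (hT : IsCompactPerturbation T Q) (hQ : IsCompact Q)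
    {B : Set Y} (hB : Bornology.IsBounded B) (habs : IsAbsorbing T B) :
    IsGlobalAttractor T (omegaLimit atTop T B) := by
  have hcont : ∀ t p, Tendsto (T t) (𝓝 p) (𝓝 (T t p)) := fun t p =>
    (T.continuous continuous_const continuous_id).tendsto p
  refine ⟨hT.isCompact_omegaLimit hQ hB, fun t => ?_, fun C hC ε hε => ?_⟩
  · refine hT.image_eq_of_inseparable (isClosed_omegaLimit _ _ _) ?_ fun p hp => ?_
    · rintro _ ⟨p, hp, rfl⟩
      obtain ⟨s, u, hs, hu, hlim⟩ := exists_seq_of_mem_omegaLimit hp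
      refine mem_omegaLimit_of_tendsto (t := fun n => t + s n)
        (tendsto_atTop_mono (fun n => le_add_of_nonneg_left t.2) hs) hu ?_
      simp only [T.map_add]
      exact (hcont t p).comp hlim
    · obtain ⟨s, u, hs, hu, hlim⟩ := exists_seq_of_mem_omegaLimit hp
      have hst : Tendsto (fun n => s n - t) atTop atTop := by
        refine tendsto_atTop.2 fun b => ?_
        filter_upwards [tendsto_atTop.1 hs (b + t)] with n hn
        exact le_tsub_of_add_le_right hn
      -- A preimage of `p` up to inseparability is a limit point of the same trajectories seen `t`
      -- earlier.
      obtain ⟨q, -, φ, hφ, h⟩ := hT.exists_tendsto hQ hst hB hu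
      refine ⟨q, mem_omegaLimit_of_tendsto (hst.comp hφ.tendsto_atTop) (fun n => hu (φ n)) h, ?_⟩
      refine tendsto_nhds_unique_inseparable ((hcont t q).comp h) ((hlim.comp hφ.tendsto_atTop).congr' ?_)
      filter_upwards [(tendsto_atTop.1 hs t |> hφ.tendsto_atTop.eventually)] with n hn
      simp only [Function.comp_apply]
      rw [← T.map_add, add_tsub_cancel_of_le hn]
  · by_contra! hcon
    have h : ∀ n : ℕ, ∃ t : ℝ≥0, (n : ℝ≥0) ≤ t ∧ ∃ u ∈ C,
        T t u ∉ Metric.thickening ε (omegaLimit atTop T B) := by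
      intro n
      obtain ⟨t, ht, hnot⟩ := hcon n
      obtain ⟨_, ⟨u, hu, rfl⟩, h⟩ := not_subset.1 hnot
      exact ⟨t, ht, u, hu, h⟩
    choose t ht u hu hnot using h
    have htt : Tendsto t atTop atTop := tendsto_atTop_mono ht tendsto_natCast_atTop_atTop
    obtain ⟨q, -, φ, hφ, hlim⟩ := hT.exists_tendsto hQ htt hC hu
    -- After time `t₁` the trajectories from `C` have entered `B`; restarting there exhibits the
    -- limit `q` as an ω-limit point of `B`.
    obtain ⟨t₁, -, h₁⟩ := habs C hC
    have hst : Tendsto (fun n => t n - t₁) atTop atTop := by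
      refine tendsto_atTop.2 fun b => ?_
      filter_upwards [tendsto_atTop.1 htt (b + t₁)] with n hn
      exact le_tsub_of_add_le_right hn
    have hq : q ∈ omegaLimit atTop T B := by
      refine mem_omegaLimit_of_tendsto (hst.comp hφ.tendsto_atTop) (u := fun n => T t₁ (u (φ n)))
        (fun n => h₁ t₁ le_rfl ⟨_, hu _, rfl⟩) (hlim.congr' ?_)
      filter_upwards [hφ.tendsto_atTop.eventually (tendsto_atTop.1 htt t₁)] with n hn
      simp only [Function.comp_apply]
      rw [← T.map_add, tsub_add_cancel_of_le hn]
    obtain ⟨n, hn⟩ := (hlim.eventually (Metric.ball_mem_nhds q hε)).exists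
    exact hnot (φ n) (Metric.mem_thickening_iff.2 ⟨q, hq, hn⟩)

end IsCompactPerturbation

/-- If all solutions decay then the set of vectors of norm zero is the global attractor. -/
theorem isGlobalAttractor_of_decay {T : Flow ℝ≥0 Y} {Q : Set Y} (hTQ : IsCompactPerturbation T Q)
    {a : ℝ} (ha : a < 1) (hT : ∀ (t : ℝ≥0) u, ‖T t u‖ ≤ Real.exp (-(1 - a) * t) * ‖u‖) :
    IsGlobalAttractor T (omegaLimit atTop T (Metric.closedBall 0 0)) ∧
      omegaLimit atTop T (Metric.closedBall 0 0) ⊆ Metric.closedBall 0 0 := by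
  have hmaps : ∀ t, T t '' Metric.closedBall 0 0 ⊆ Metric.closedBall 0 0 := by
    rintro t _ ⟨u, hu, rfl⟩
    rw [mem_closedBall_zero_iff] at hu ⊢
    refine (hT t u).trans ?_
    rw [hu.antisymm (norm_nonneg u), mul_zero]
  have hinsep : ∀ {p q : Y}, p ∈ Metric.closedBall (0 : Y) 0 → q ∈ Metric.closedBall (0 : Y) 0 →
      Inseparable p q := by
    intro p q hp hq
    rw [Metric.inseparable_iff]
    refine le_antisymm ((dist_triangle_right p q 0).trans ?_) dist_nonneg
    linarith [Metric.mem_closedBall.1 hp, Metric.mem_closedBall.1 hq]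
  have h0 : (0 : Y) ∈ Metric.closedBall (0 : Y) 0 := Metric.mem_closedBall_self le_rfl
  have heq : omegaLimit atTop T (Metric.closedBall 0 0) = Metric.closedBall 0 0 := by
    refine Subset.antisymm ?_ fun p hp => ?_
    · refine (omegaLimit_subset_closure_image2 _ _ _ univ_mem).trans
        (closure_minimal ?_ Metric.isClosed_closedBall)
      rintro _ ⟨t, -, u, hu, rfl⟩
      exact hmaps t ⟨u, hu, rfl⟩
    · have h := hinsep hp (hmaps 0 ⟨0, h0, rfl⟩)
      refine (h.mem_closed_iff (isClosed_omegaLimit _ _ _)).2 ?_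
      refine mem_omegaLimit_of_tendsto (t := fun n => n) (u := fun _ => 0)
        tendsto_natCast_atTop_atTop (fun _ => h0) ?_
      have hc : ∀ n : ℕ, Inseparable (T n 0) (T 0 0) := fun n =>
        hinsep (hmaps n ⟨0, h0, rfl⟩) (hmaps 0 ⟨0, h0, rfl⟩)
      exact tendsto_iff_dist_tendsto_zero.2
        (by simp only [fun n => Metric.inseparable_iff.1 (hc n), tendsto_const_nhds])
  rw [heq]
  refine ⟨⟨?_, fun t => ?_, fun C hC ε hε => ?_⟩, Subset.rfl⟩
  · rw [Metric.closedBall_zero']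
    exact isCompact_singleton.closure
  · exact hTQ.image_eq_of_inseparable Metric.isClosed_closedBall (hmaps t) fun p hp =>
      ⟨0, h0, hinsep (hmaps t ⟨0, h0, rfl⟩) hp⟩
  · obtain ⟨t₀, -, h⟩ := isAbsorbing_closedBall (R := ε / 2) ha
      (fun t u => (hT t u).trans_eq (zero_add _).symm) (by positivity) C hC
    refine ⟨t₀, fun t ht => (h t ht).trans fun p hp => ?_⟩
    exact Metric.mem_thickening_iff.2 ⟨0, h0, (Metric.mem_closedBall.1 hp).trans_lt (half_lt_self hε)⟩

end Attractor

/-! ### Derivatives in a seminormed space via its separation quotient. -/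

section SeminormedDerivative

variable {Y : Type*} [SeminormedAddCommGroup Y] [NormedSpace ℝ Y]

theorem hasDerivWithinAt_separationQuotient_mk_iff {u : ℝ → Y} {g : Y} {s : Set ℝ} {t : ℝ} :
    HasDerivWithinAt (fun r => SeparationQuotient.mk (u r)) (SeparationQuotient.mk g) s t ↔
      HasDerivWithinAt u g s t := by
  have h : ∀ p : ℝ × ℝ,
      ‖SeparationQuotient.mk (u p.1) - SeparationQuotient.mk (u p.2) -
        (ContinuousLinearMap.toSpanSingleton ℝ (SeparationQuotient.mk g)) (p.1 - p.2)‖ =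
      ‖u p.1 - u p.2 - (ContinuousLinearMap.toSpanSingleton ℝ g) (p.1 - p.2)‖ := fun p =>
    SeparationQuotient.norm_mk (u p.1 - u p.2 - (p.1 - p.2) • g)
  constructor <;> intro hd <;>
    refine ⟨Asymptotics.isLittleOTVS_iff_isLittleO.2 (Asymptotics.isLittleO_norm_left.1 ?_)⟩ <;>
    have h' := Asymptotics.isLittleO_norm_left.2
      (Asymptotics.isLittleOTVS_iff_isLittleO.1 hd.isLittleOTVS)
  · simpa only [h] using h'
  · simpa only [h] using h'

theorem continuousWithinAt_of_hasDerivWithinAt_seminormed {u : ℝ → Y} {g : Y} {s : Set ℝ} {t : ℝ}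
    (h : HasDerivWithinAt u g s t) : ContinuousWithinAt u s t :=
  SeparationQuotient.isInducing_mk.continuousWithinAt_iff.2
    (hasDerivWithinAt_separationQuotient_mk_iff.2 h).continuousWithinAt

variable {E : Type*} [NormedAddCommGroup E] [NormedSpace ℝ E] {ι : E →L[ℝ] Y} {F : Y → E}
  {u : Y} {z : ℝ → E}

theorem IsDuhamelSolution.hasDerivWithinAt (hz : IsDuhamelSolution ι F u z) {t : ℝ} (ht : 0 ≤ t) :
    HasDerivWithinAt (fun s => Real.exp (-s) • (u + ι (z s)))
      (-(Real.exp (-t) • (u + ι (z t))) + ι (F (Real.exp (-t) • (u + ι (z t))))) (Ici 0) t := by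
  rw [← hasDerivWithinAt_separationQuotient_mk_iff]
  let p : E →L[ℝ] SeparationQuotient Y := (SeparationQuotient.mkCLM ℝ Y).comp ι
  have h1 : HasDerivWithinAt (fun s => SeparationQuotient.mk u + p (z s)) _ (Ici 0) t :=
    (p.hasFDerivAt.comp_hasDerivWithinAt t (hz.2 t ht)).const_add _
  have h2 : HasDerivWithinAt (fun s => Real.exp (-s)) (Real.exp (-t) * -1) (Ici 0) t :=
    ((hasDerivAt_neg t).exp).hasDerivWithinAt
  refine (h2.smul h1).congr_deriv ?_
  have h3 : p (duhamelField ι F u t (z t)) =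
      Real.exp t • p (F (Real.exp (-t) • (u + ι (z t)))) := map_smul _ _ _
  rw [h3, smul_smul, ← Real.exp_add, neg_add_cancel, Real.exp_zero, one_smul, mul_neg_one,
    neg_smul, add_comm]
  rfl

end SeminormedDerivative

/-! ### The nonlocal operator on `CRho ρ` and its solutions. -/

section WeightedSpace

open scoped BoundedContinuousFunction

variable {N : ℕ} {J ρ h : EuclideanSpace ℝ (Fin N) → ℝ}

namespace CRho

theorem continuous_coe (u : CRho ρ) : Continuous u := u.2.1

theorem ext {u v : CRho ρ} (H : ∀ x, u x = v x) : u = v := Subtype.ext (funext H)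

theorem abs_mul_abs_le_norm (u : CRho ρ) (x : EuclideanSpace ℝ (Fin N)) :
    |u x| * |ρ x| ≤ ‖u‖ :=
  le_ciSup u.bddAbove x

theorem norm_le_of_forall {u : CRho ρ} {c : ℝ} (H : ∀ x, |u x| * |ρ x| ≤ c) : ‖u‖ ≤ c :=
  ciSup_le H

theorem abs_mul_weight_le (w : EuclideanSpace ℝ (Fin N) →ᵇ ℝ) {P : ℝ} (hP : ∀ x, |ρ x| ≤ P)
    (x : EuclideanSpace ℝ (Fin N)) : |w x| * |ρ x| ≤ P * ‖w‖ := by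
  rw [mul_comm]
  exact mul_le_mul (hP x) (w.norm_coe_le_norm x) (abs_nonneg _) ((abs_nonneg _).trans (hP x))

/-- Bounded continuous functions as elements of `C_ρ(ℝᴺ)`, for a bounded weight. -/
def ofBounded {P : ℝ} (hP : ∀ x, |ρ x| ≤ P) :
    (EuclideanSpace ℝ (Fin N) →ᵇ ℝ) →L[ℝ] CRho ρ :=
  LinearMap.mkContinuous
    { toFun := fun w => (⟨w, w.continuous, P * ‖w‖, by
        rintro _ ⟨x, rfl⟩
        exact abs_mul_weight_le w hP x⟩ : weightedSubmodule ρ)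
      map_add' := fun _ _ => rfl
      map_smul' := fun _ _ => rfl } P
    fun w => norm_le_of_forall (abs_mul_weight_le w hP)

theorem ofBounded_apply {P : ℝ} (hP : ∀ x, |ρ x| ≤ P) (w : EuclideanSpace ℝ (Fin N) →ᵇ ℝ)
    (x : EuclideanSpace ℝ (Fin N)) : ofBounded hP w x = w x := rfl

end CRho

/-- `F` is the operator `u ↦ ∫ J (x - y) f(u(y)) ρ(y) dy + h(x)`. -/
def IsNonlocalOperator (J ρ h : EuclideanSpace ℝ (Fin N) → ℝ) (f : ℝ → ℝ)
    (F : CRho ρ → EuclideanSpace ℝ (Fin N) →ᵇ ℝ) : Prop :=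
  ∀ u x, F u x = (∫ y, J (x - y) * (f (u y) * ρ y)) + h x

variable {f : ℝ → ℝ} {F : CRho ρ → EuclideanSpace ℝ (Fin N) →ᵇ ℝ}

theorem exists_isNonlocalOperator (hJ : Integrable J) (hρ : Integrable ρ) {P : ℝ}
    (hP : ∀ x, |ρ x| ≤ P) (hh : Continuous h) {H : ℝ} (hH : ∀ x, |h x| ≤ H) (hf : Continuous f)
    {M : ℝ} (hM : ∀ s, |f s| ≤ M) :
    ∃ F : CRho ρ → EuclideanSpace ℝ (Fin N) →ᵇ ℝ, IsNonlocalOperator J ρ h f F := by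
  refine ⟨fun u => BoundedContinuousFunction.ofNormedAddCommGroup _
    ((continuous_integral_kernel hJ (integrable_mul_weight hρ
      (hf.comp u.continuous_coe).aestronglyMeasurable fun y => hM _)
      (abs_mul_le_of_bounds (fun y => hM (u y)) hP)).add hh) ((∫ y, |J y|) * (M * P) + H)
    fun x => ?_, fun u x => rfl⟩
  exact (norm_add_le _ _).trans (add_le_add
    (abs_integral_kernel_le hJ (abs_mul_le_of_bounds (fun y => hM (u y)) hP) x) (hH x))

namespace IsNonlocalOperator

theorem norm_le (hF : IsNonlocalOperator J ρ h f F) (hJ : Integrable J) {P : ℝ}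
    (hP : ∀ x, |ρ x| ≤ P) {H : ℝ} (hH : ∀ x, |h x| ≤ H) {M : ℝ} (hM : ∀ s, |f s| ≤ M)
    (u : CRho ρ) : ‖F u‖ ≤ (∫ y, |J y|) * (M * P) + H := by
  refine (F u).norm_le_of_nonempty.2 fun x => ?_
  rw [hF]
  exact (norm_add_le _ _).trans (add_le_add
    (abs_integral_kernel_le hJ (abs_mul_le_of_bounds (fun y => hM (u y)) hP) x) (hH x))

/-- The weight inside the integral turns the pointwise bound `k |u - v| |ρ|` into `k ‖u - v‖`, so
the weighted seminorm controls the sup norm of the output. -/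
theorem lipschitzWith (hF : IsNonlocalOperator J ρ h f F) (hJ : Integrable J) (hρ : Integrable ρ)
    {P : ℝ} (hP : ∀ x, |ρ x| ≤ P) {k : ℝ≥0} (hf : LipschitzWith k f) {M : ℝ}
    (hM : ∀ s, |f s| ≤ M) : LipschitzWith (Real.toNNReal (∫ y, |J y|) * k) F := by
  have hJ0 : 0 ≤ ∫ y, |J y| := integral_nonneg fun y => abs_nonneg _
  refine LipschitzWith.of_dist_le_mul fun u v => ?_
  refine (BoundedContinuousFunction.dist_le (by positivity)).2 fun x => ?_
  have hi : ∀ w : CRho ρ, Integrable fun y => J (x - y) * (f (w y) * ρ y) := fun w =>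
    integrable_kernel hJ
      ((hf.continuous.comp w.continuous_coe).aestronglyMeasurable.mul hρ.aestronglyMeasurable)
      (abs_mul_le_of_bounds (fun y => hM (w y)) hP) x
  rw [hF, hF, Real.dist_eq, add_sub_add_right_eq_sub, ← integral_sub (hi u) (hi v)]
  simp only [← mul_sub, ← sub_mul]
  rw [NNReal.coe_mul, Real.coe_toNNReal _ hJ0, mul_assoc, dist_eq_norm]
  refine abs_integral_kernel_le hJ (fun y => ?_) x
  rw [abs_mul]
  calc |f (u y) - f (v y)| * |ρ y| ≤ k * |u y - v y| * |ρ y| :=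
        mul_le_mul_of_nonneg_right (hf.dist_le_mul _ _) (abs_nonneg _)
    _ = k * (|(u - v) y| * |ρ y|) := mul_assoc _ _ _
    _ ≤ k * ‖u - v‖ := mul_le_mul_of_nonneg_left ((u - v).abs_mul_abs_le_norm y) k.2

/-- The weight acts twice, inside the integral and in the seminorm; hence `P ^ 2` with `K`, but only
`P` with `η`, where one weight is absorbed by `‖u‖`. -/
theorem norm_ofBounded_le (hF : IsNonlocalOperator J ρ h f F) (hJ : Integrable J) {P : ℝ}
    (hP : ∀ x, |ρ x| ≤ P) (hh : BddAbove (range fun x => |h x| * |ρ x|)) {η K : ℝ} (hη : 0 ≤ η)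
    (hK : 0 ≤ K) (hf : ∀ s, |f s| ≤ η * |s| + K) (u : CRho ρ) :
    ‖CRho.ofBounded hP (F u)‖ ≤ η * (∫ y, |J y|) * P * ‖u‖ +
      ((∫ y, |J y|) * P ^ 2 * K + ⨆ x, |h x| * |ρ x|) := by
  have hJ0 : 0 ≤ ∫ y, |J y| := integral_nonneg fun y => abs_nonneg _
  have hq : ∀ y, |f (u y) * ρ y| ≤ η * ‖u‖ + K * P := fun y => by
    rw [abs_mul]
    calc |f (u y)| * |ρ y| ≤ (η * |u y| + K) * |ρ y| :=
          mul_le_mul_of_nonneg_right (hf _) (abs_nonneg _)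
      _ = η * (|u y| * |ρ y|) + K * |ρ y| := by ring
      _ ≤ η * ‖u‖ + K * P := by
        gcongr
        exacts [u.abs_mul_abs_le_norm y, hP y]
  refine CRho.norm_le_of_forall fun x => ?_
  rw [CRho.ofBounded_apply, hF]
  have hP0 : 0 ≤ P := (abs_nonneg _).trans (hP x)
  calc |(∫ y, J (x - y) * (f (u y) * ρ y)) + h x| * |ρ x|
      ≤ (|∫ y, J (x - y) * (f (u y) * ρ y)| + |h x|) * |ρ x| :=
        mul_le_mul_of_nonneg_right (abs_add_le _ _) (abs_nonneg _)
    _ = |∫ y, J (x - y) * (f (u y) * ρ y)| * |ρ x| + |h x| * |ρ x| := add_mul _ _ _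
    _ ≤ (∫ y, |J y|) * (η * ‖u‖ + K * P) * P + ⨆ x, |h x| * |ρ x| := by
      refine add_le_add ?_ (le_ciSup hh x)
      exact mul_le_mul (abs_integral_kernel_le hJ hq x) (hP x) (abs_nonneg _) (by positivity)
    _ = _ := by ring

theorem exists_isCompact_convex (hF : IsNonlocalOperator J ρ h f F) (hJ : Integrable J)
    (hρ : Integrable ρ) {P : ℝ} (hP : ∀ x, |ρ x| ≤ P) (hh : Continuous h) {H : ℝ}
    (hH : ∀ x, |h x| ≤ H) (hf : Continuous f) {M : ℝ} (hM : ∀ s, |f s| ≤ M) :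
    ∃ S : Set (EuclideanSpace ℝ (Fin N) →ᵇ ℝ), Convex ℝ S ∧ IsCompact S ∧ ∀ u, F u ∈ S := by
  let w : EuclideanSpace ℝ (Fin N) →ᵇ ℝ := BoundedContinuousFunction.ofNormedAddCommGroup h hh H hH
  refine ⟨(fun v => v + w) '' closure (kernelSet J ρ M), ?_,
    (isCompact_closure_kernelSet hJ hρ hP M).image (by fun_prop), fun u => ?_⟩
  · have := (convex_kernelSet hJ hρ hP M).closure.translate w
    simpa only [add_comm] using this
  · refine ⟨F u - w, subset_closure ⟨fun y => f (u y),
      (hf.comp u.continuous_coe).aestronglyMeasurable, fun y => hM _, fun x => ?_⟩,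
      sub_add_cancel _ _⟩
    change F u x - h x = _
    rw [hF, add_sub_cancel_right]

theorem nonlocalField_eq (hF : IsNonlocalOperator J ρ h f F) (u : CRho ρ)
    (x : EuclideanSpace ℝ (Fin N)) : nonlocalField J ρ h f u x = -u x + F u x := by
  rw [hF, nonlocalField, add_assoc]
  simp only [mul_assoc]

end IsNonlocalOperator

/-- The pointwise equation needs its own proof, since the seminorm does not see points where `ρ`
vanishes; it comes from evaluating `z`, which is differentiable in the sup norm. -/
theorem IsDuhamelSolution.isSolution {P : ℝ} {hP : ∀ x, |ρ x| ≤ P}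
    (hF : IsNonlocalOperator J ρ h f F) {u₀ : CRho ρ}
    {z : ℝ → EuclideanSpace ℝ (Fin N) →ᵇ ℝ} (hz : IsDuhamelSolution (CRho.ofBounded hP) F u₀ z)
    {u : ℝ → CRho ρ}
    (hu : ∀ t, 0 ≤ t → u t = Real.exp (-t) • (u₀ + CRho.ofBounded hP (z t))) :
    IsSolution J ρ h f u := by
  intro t ht
  have hd := hz.hasDerivWithinAt ht
  rw [← hu t ht] at hd
  refine ⟨⟨-u t + CRho.ofBounded hP (F (u t)), fun x => (hF.nonlocalField_eq (u t) x).symm, ?_⟩,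
    fun x => ?_⟩
  · rw [← hasDerivWithinAt_separationQuotient_mk_iff] at hd ⊢
    refine hd.congr_of_mem (fun s hs => ?_) ht
    rw [hu s hs]
  · let p := BoundedContinuousFunction.evalCLM ℝ (α := EuclideanSpace ℝ (Fin N)) (β := ℝ) x
    have h1 : HasDerivWithinAt (fun s => u₀ x + p (z s)) _ (Ici 0) t :=
      (p.hasFDerivAt.comp_hasDerivWithinAt t (hz.2 t ht)).const_add _
    have h2 : HasDerivWithinAt (fun s => Real.exp (-s)) (Real.exp (-t) * -1) (Ici 0) t :=
      ((hasDerivAt_neg t).exp).hasDerivWithinAt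
    have hux : ∀ s ∈ Ici (0 : ℝ), u s x = Real.exp (-s) * (u₀ x + p (z s)) := fun s hs => by
      rw [hu s hs]
      rfl
    refine ((h2.mul h1).congr_of_mem hux ht).congr_deriv ?_
    have h3 : p (duhamelField (CRho.ofBounded hP) F u₀ t (z t)) = Real.exp t * F (u t) x := by
      rw [hu t ht]
      rfl
    rw [h3, hF.nonlocalField_eq, hux t ht, ← mul_assoc, ← Real.exp_add, neg_add_cancel,
      Real.exp_zero]
    ring

/-- Every solution of the evolution equation is given by Duhamel's formula. -/
theorem IsSolution.exists_isDuhamelSolution {P : ℝ} (hP : ∀ x, |ρ x| ≤ P)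
    (hF : IsNonlocalOperator J ρ h f F) (hFc : Continuous F) {u : ℝ → CRho ρ}
    (hu : IsSolution J ρ h f u) :
    ∃ z, IsDuhamelSolution (CRho.ofBounded hP) F (u 0) z ∧
      ∀ t, 0 ≤ t → u t = Real.exp (-t) • (u 0 + CRho.ofBounded hP (z t)) := by
  have hucont : ContinuousOn u (Ici 0) := fun t ht => by
    obtain ⟨g, -, hg⟩ := (hu t ht).1
    exact continuousWithinAt_of_hasDerivWithinAt_seminormed hg
  -- Freezing `u` at its initial value for negative times makes the integrand continuous on all of
  -- `ℝ`.
  have humax : Continuous fun s : ℝ => u (max s 0) :=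
    hucont.comp_continuous (by fun_prop) fun s => mem_Ici.2 (le_max_right s 0)
  have hG : Continuous fun s : ℝ => Real.exp s • F (u (max s 0)) :=
    Real.continuous_exp.smul (hFc.comp humax)
  let z : ℝ → EuclideanSpace ℝ (Fin N) →ᵇ ℝ := fun t =>
    ∫ s in (0 : ℝ)..t, Real.exp s • F (u (max s 0))
  have hz : ∀ t, 0 ≤ t → HasDerivAt z (Real.exp t • F (u t)) t := fun t ht => by
    have := (hG.integral_hasStrictDerivAt 0 t).hasDerivAt
    rwa [max_eq_left ht] at this
  have hz0 : z 0 = 0 := intervalIntegral.integral_same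
  have heq : ∀ t, 0 ≤ t → u t = Real.exp (-t) • (u 0 + CRho.ofBounded hP (z t)) := by
    intro t ht
    refine CRho.ext fun x => ?_
    let p := BoundedContinuousFunction.evalCLM ℝ (α := EuclideanSpace ℝ (Fin N)) (β := ℝ) x
    -- A seminorm argument would identify `u` only up to norm zero; the pointwise clause of
    -- `IsSolution` makes this quantity constant at each `x`.
    have hd : ∀ s, 0 ≤ s → HasDerivWithinAt (fun s => Real.exp s * u s x - p (z s)) 0 (Ici 0) s :=
      fun s hs => by
        have h1 : HasDerivWithinAt (fun s => p (z s)) (Real.exp s * F (u s) x) (Ici 0) s :=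
          p.hasFDerivAt.comp_hasDerivWithinAt s (hz s hs).hasDerivWithinAt
        refine (((Real.hasDerivAt_exp s).hasDerivWithinAt.mul ((hu s hs).2 x)).sub h1).congr_deriv ?_
        rw [hF.nonlocalField_eq]
        ring
    have h1 := constant_of_has_deriv_right_zero (a := 0) (b := t)
      (fun s hs => (hd s hs.1).continuousWithinAt.mono Icc_subset_Ici_self)
      (fun s hs => (hd s hs.1).mono (Ici_subset_Ici.2 hs.1)) t ⟨ht, le_rfl⟩
    rw [hz0, map_zero, Real.exp_zero, one_mul, sub_zero, sub_eq_iff_eq_add] at h1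
    change u t x = Real.exp (-t) * (u 0 x + p (z t))
    rw [← h1, ← mul_assoc, ← Real.exp_add, neg_add_cancel, Real.exp_zero, one_mul]
  refine ⟨z, ⟨hz0, fun t ht => ?_⟩, heq⟩
  rw [duhamelField, ← heq t ht]
  exact (hz t ht).hasDerivWithinAt

end WeightedSpace

/-! ### The theorem for the nonlocal equation. -/

theorem coeff_nonneg_of_abs_le {f : ℝ → ℝ} {η K : ℝ} (hf : ∀ s, |f s| ≤ η * |s| + K) :
    0 ≤ η ∧ 0 ≤ K := by
  have hK : 0 ≤ K := by simpa using (abs_nonneg _).trans (hf 0)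
  refine ⟨?_, hK⟩
  by_contra! hη
  -- At this point the bound `η * |s| + K` would equal `-1`.
  have h := (abs_nonneg _).trans (hf ((K + 1) / (-η)))
  rw [abs_of_nonneg (div_nonneg (by linarith) (by linarith))] at h
  have h2 : η * ((K + 1) / (-η)) = -(K + 1) := by
    rw [mul_div_assoc', div_eq_iff (by linarith)]
    ring
  linarith

end

theorem mainTheorem1 {N : ℕ} (f : ℝ → ℝ) (J ρ h : EuclideanSpace ℝ (Fin N) → ℝ)
    (hJ_nonneg : ∀ x, 0 ≤ J x) (hJ_int : Integrable J)
    (hρ_nonneg : ∀ x, 0 ≤ ρ x) (hρ_symm : ∀ x, ρ (-x) = ρ x)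
    (hρ_bdd : BddAbove (range ρ)) (hρ_int : Integrable ρ)
    (hh_bdd : BddAbove (range fun x => |h x|)) (hh_diff : Differentiable ℝ h)
    (hh_deriv : ∃ C : ℝ, ∀ x, ‖fderiv ℝ h x‖ ≤ C)
    (hf_lip : ∃ k : ℝ≥0, LipschitzWith k f) (hf_bdd : ∃ M : ℝ, ∀ s, |f s| ≤ M)
    (η K : ℝ) (hf_diss : ∀ s, |f s| ≤ η * |s| + K)
    (hη : η * (∫ x, |J x|) * (⨆ x, |ρ x|) < 1) :
    ∃ T : Flow ℝ≥0 (CRho ρ), IsGeneratedFlow J ρ h f T ∧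
      (∀ δ R : ℝ, η * (∫ x, |J x|) * (⨆ x, |ρ x|) < δ → δ < 1 →
        ((∫ x, |J x|) * (⨆ x, |ρ x|) ^ 2 * K + ⨆ x, |h x| * |ρ x|) /
            (δ - η * (∫ x, |J x|) * (⨆ x, |ρ x|)) ≤ R →
        (0 < R → IsAbsorbing T (Metric.closedBall 0 R)) ∧
        IsGlobalAttractor T (omegaLimit atTop T (Metric.closedBall 0 R)) ∧
        omegaLimit atTop T (Metric.closedBall 0 R) ⊆ Metric.closedBall 0 R) ∧
      ∀ R : ℝ, IsAbsorbing T (Metric.closedBall 0 R) →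
        IsGlobalAttractor T (omegaLimit atTop T (Metric.closedBall 0 R)) ∧
        omegaLimit atTop T (Metric.closedBall 0 R) ⊆ Metric.closedBall 0 R := by
  obtain ⟨k, hk⟩ := hf_lip
  obtain ⟨M, hM⟩ := hf_bdd
  obtain ⟨hη0, hK0⟩ := coeff_nonneg_of_abs_le hf_diss
  have hP : ∀ x, |ρ x| ≤ ⨆ x, |ρ x| :=
    le_ciSup (by simpa only [abs_of_nonneg (hρ_nonneg _)] using hρ_bdd)
  have hH : ∀ x, |h x| ≤ ⨆ x, |h x| := le_ciSup hh_bdd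
  have hhρ : BddAbove (range fun x => |h x| * |ρ x|) := by
    refine ⟨(⨆ x, |h x|) * ⨆ x, |ρ x|, ?_⟩
    rintro _ ⟨x, rfl⟩
    exact mul_le_mul (hH x) (hP x) (abs_nonneg _) ((abs_nonneg _).trans (hH x))
  have hJ0 : 0 ≤ ∫ x, |J x| := integral_nonneg fun x => abs_nonneg _
  have hh0 : 0 ≤ ⨆ x, |h x| * |ρ x| :=
    Real.iSup_nonneg fun x => mul_nonneg (abs_nonneg _) (abs_nonneg _)
  obtain ⟨F, hF⟩ := exists_isNonlocalOperator hJ_int hρ_int hP hh_diff.continuous hH hk.continuous hM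
  have hFlip := hF.lipschitzWith hJ_int hρ_int hP hk hM
  have hFdiss := hF.norm_ofBounded_le hJ_int hP hhρ hη0 hK0 hf_diss
  obtain ⟨S, hS, hSc, hFS⟩ :=
    hF.exists_isCompact_convex hJ_int hρ_int hP hh_diff.continuous hH hk.continuous hM
  obtain ⟨T, z, hz, hT⟩ :=
    exists_flow_of_lipschitzWith (CRho.ofBounded hP) hFlip (hF.norm_le hJ_int hP hH hM)
  obtain ⟨Q, hQ, hQT⟩ := exists_isCompact_duhamel (CRho.ofBounded hP) hS hSc hFS
  have hTQ : IsCompactPerturbation T Q := by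
    refine ⟨fun t u => ?_, fun t u m hm => ?_⟩
    · rw [hT]
      exact hQT u _ (hz u) t t.2
    · rw [hT, hT, IsDuhamelSolution.eq_of_norm_sub_eq_zero hFlip (hz (u + m)) (hz u)
        (by rwa [add_sub_cancel_left]) t.coe_nonneg, ← smul_add, add_right_comm]
  set a := η * (∫ x, |J x|) * (⨆ x, |ρ x|)
  set b := (∫ x, |J x|) * (⨆ x, |ρ x|) ^ 2 * K + ⨆ x, |h x| * |ρ x|
  have hb : 0 ≤ b := by positivity
  have hdecay : ∀ (t : ℝ≥0) u, ‖T t u‖ ≤ b / (1 - a) + Real.exp (-(1 - a) * t) * ‖u‖ :=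
    fun t u => by
      rw [hT]
      exact (hz u).norm_exp_smul_le hη hFdiss t.2
  have hattr : ∀ R : ℝ, IsAbsorbing T (Metric.closedBall 0 R) →
      IsGlobalAttractor T (omegaLimit atTop T (Metric.closedBall 0 R)) ∧
      omegaLimit atTop T (Metric.closedBall 0 R) ⊆ Metric.closedBall 0 R := fun R hR =>
    ⟨hTQ.isGlobalAttractor_omegaLimit hQ Metric.isBounded_closedBall hR,
      omegaLimit_subset_of_isAbsorbing Metric.isBounded_closedBall Metric.isClosed_closedBall hR⟩
  refine ⟨T, fun u => ⟨fun hu t => ?_, fun hu => ?_⟩, fun δ R hδ hδ1 hR => ?_, hattr⟩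
  · obtain ⟨w, hw, huw⟩ := hu.exists_isDuhamelSolution hP hF hFlip.continuous
    rw [huw t t.2, hT, IsDuhamelSolution.eq_of_norm_sub_eq_zero hFlip hw (hz (u 0)) (by simp)
      t.coe_nonneg]
  · exact (hz (u 0)).isSolution hF fun t ht => (hu ⟨t, ht⟩).trans (hT _ _)
  · have hδa : 0 < δ - a := sub_pos.2 hδ
    have habs : 0 < R → IsAbsorbing T (Metric.closedBall 0 R) := fun hR0 => by
      refine isAbsorbing_closedBall hη hdecay ?_
      -- The goal is `b / (1 - a) < R`. If `b > 0`, `δ < 1` makes `b / (1 - a) < b / (δ - a) ≤ R`;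
      -- if `b = 0`, only `0 < R` is needed.
      rcases hb.eq_or_lt with hb0 | hb0
      · rwa [← hb0, zero_div]
      · exact (div_lt_div_of_pos_left hb0 hδa (by linarith)).trans_le hR
    refine ⟨habs, ?_⟩
    -- The radius `R = 0` is allowed only when `b = 0`. The ball need not absorb then, but all
    -- solutions decay exponentially.
    rcases ((div_nonneg hb hδa.le).trans hR).eq_or_lt with hR0 | hR0
    · have hb0 : b = 0 := by
        rw [← hR0, div_le_iff₀ hδa, zero_mul] at hR
        exact hR.antisymm hb
      rw [← hR0]
      refine isGlobalAttractor_of_decay hTQ hη fun t u => ?_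
      simpa only [hb0, zero_div, zero_add] using hdecay t u
    · exact hattr R (habs hR0)
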